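/- Let $D$ be an integral domain with quotient field $K$, and let $\star$ be a semistar operation on $D$, i.e. a map $E\mapsto E^\star$ from the set of nonzero $D$-submodules of $K$ to itself such that, for all nonzero $D$-submodules $E,F$ of $K$ and all nonzero $x\in K$: $(xE)^\star=xE^\star$; $E\subseteq F$ implies $E^\star\subseteq F^\star$; $E\subseteq E^\star$ and $(E^\star)^\star=E^\star$. Let $\star_f$ be the associated finite-type semistar operation, $E^{\star_f}=\bigcup\{F^\star : F\subseteq E \text{ a nonzero finitely generated } D\text{-submodule of } K\}$. A quasi-$\star_f$-prime of $D$ is a nonzero prime ideal $P$ of $D$ with $P=P^{\star_f}\cap D$, and $P$ is $\star_f$-idempotent if $P^{\star_f}=(P^2)^{\star_f}$. A prime ideal $P$ of a ring is branched if there is a $P$-primary ideal distinct from $P$. The domain $D$ is a P$\star$MD if $(FF^{-1})^{\star_f}=D^{\star_f}$ for every nonzero finitely generated $D$-submodule $F$ of $K$, where $F^{-1}=\{u\in K : uF\subseteq D\}$. A P$\star$MD is $\star_f$-discrete (respectively $\star_f$-strongly discrete) if it has no branched $\star_f$-idempotent quasi-$\star_f$-prime ideals (respectively no $\star_f$-idempotent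 quasi-$\star_f$-prime ideals). A Prüfer domain (an integral domain, possibly a field, in which every nonzero finitely generated ideal is invertible) is discrete (respectively strongly discrete) if it has no nonzero branched idempotent prime ideals (respectively no nonzero idempotent prime ideals). Let $\mathrm{Na}(D,\star)=D[X]_{N(\star)}$ be the semistar Nagata ring, where $N(\star)=\{g\in D[X] : g\neq 0,\ c(g)^\star=D^\star\}$ and $c(g)$ is the ideal of $D$ generated by the coefficients of $g$. Then: (1) $D$ is a $\star_f$-discrete P$\star$MD if and only if $\mathrm{Na}(D,\star)$ is a discrete Prüfer domain; (2) $D$ is a $\star_f$-strongly discrete P$\star$MD if and only if $\mathrm{Na}(D,\star)$ is a strongly discrete Prüfer domain. -/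

import Mathlib

open scoped Pointwise Polynomial nonZeroDivisors

/-- A semistar operation on the domain `D` with quotient field `K`: a map `E ↦ E^⋆` on the nonzero
`D`-submodules of `K`, satisfying the three usual axioms. The map is extended to all submodules by
`0^⋆ = 0`, which determines the extension uniquely and loses nothing, since the axioms then hold
for the zero submodule as well. -/
structure SemistarOperation (D K : Type*) [CommRing D] [Field K] [Algebra D K] where
  star : Submodule D K → Submodule D K
  star_bot : star ⊥ = ⊥
  star_smul : ∀ (x : K), x ≠ 0 → ∀ E : Submodule D K, star (x • E) = x • star E
  star_mono : ∀ E F : Submodule D K, E ≤ F → star E ≤ star F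
  le_star : ∀ E : Submodule D K, E ≤ star E
  star_star : ∀ E : Submodule D K, star (star E) = star E

namespace SemistarOperation

variable {D K : Type*} [CommRing D] [Field K] [Algebra D K] (s : SemistarOperation D K)

theorem star_mul_star_le (E F : Submodule D K) : s.star E * s.star F ≤ s.star (E * F) := by
  have key : ∀ A B : Submodule D K, A * s.star B ≤ s.star (A * B) := by
    intro A B
    rw [Submodule.mul_le]
    intro x hx y hy
    by_cases h0 : x = 0
    · simp [h0]
    · have h1 : x • B ≤ A * B := by
        intro z hz
        obtain ⟨b, hb, rfl⟩ := (Submodule.mem_smul_pointwise_iff_exists _ _ _).1 hz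
        exact Submodule.mul_mem_mul hx hb
      have h2 := s.star_mono _ _ h1
      rw [s.star_smul x h0] at h2
      exact h2 (Submodule.smul_mem_pointwise_smul y x _ hy)
  calc s.star E * s.star F ≤ s.star (s.star E * F) := key _ _
    _ = s.star (F * s.star E) := by rw [mul_comm]
    _ ≤ s.star (s.star (F * E)) := s.star_mono _ _ (key _ _)
    _ = s.star (E * F) := by rw [s.star_star, mul_comm]

/-- The underlying map of `⋆_f`: the submodule `E^{⋆_f}` is the union of all `F^⋆`, where `F` runs
over the finitely generated submodules of `E`. -/
def finiteTypeStar (E : Submodule D K) : Submodule D K where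
  carrier := {x | ∃ F : Submodule D K, F.FG ∧ F ≤ E ∧ x ∈ s.star F}
  zero_mem' := ⟨⊥, Submodule.fg_bot, bot_le, Submodule.zero_mem _⟩
  add_mem' := by
    rintro a b ⟨F, hF, hFE, ha⟩ ⟨G, hG, hGE, hb⟩
    exact ⟨F ⊔ G, hF.sup hG, sup_le hFE hGE,
      Submodule.add_mem _ (s.star_mono _ _ le_sup_left ha) (s.star_mono _ _ le_sup_right hb)⟩
  smul_mem' := by
    rintro c a ⟨F, hF, hFE, ha⟩
    exact ⟨F, hF, hFE, Submodule.smul_mem _ c ha⟩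

theorem mem_finiteTypeStar {E : Submodule D K} {x : K} :
    x ∈ s.finiteTypeStar E ↔ ∃ F : Submodule D K, F.FG ∧ F ≤ E ∧ x ∈ s.star F := Iff.rfl

theorem le_finiteTypeStar (E : Submodule D K) : E ≤ s.finiteTypeStar E := by
  intro x hx
  exact ⟨Submodule.span D {x}, Submodule.fg_span_singleton x,
    by rwa [Submodule.span_singleton_le_iff_mem], s.le_star _ (Submodule.mem_span_singleton_self x)⟩

theorem finiteTypeStar_mono {E F : Submodule D K} (h : E ≤ F) :
    s.finiteTypeStar E ≤ s.finiteTypeStar F := by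
  rintro x ⟨G, hG, hGE, hx⟩
  exact ⟨G, hG, hGE.trans h, hx⟩

/-- A finitely generated submodule of `E^{⋆_f}` lies in `G^⋆` for a single finitely generated
submodule `G` of `E`. -/
theorem exists_fg_of_le_finiteTypeStar {E F : Submodule D K} (hF : F.FG)
    (h : F ≤ s.finiteTypeStar E) : ∃ G : Submodule D K, G.FG ∧ G ≤ E ∧ F ≤ s.star G := by
  induction F, hF using Submodule.fg_induction with
  | singleton x =>
    obtain ⟨G, hG, hGE, hx⟩ := h (Submodule.mem_span_singleton_self x)
    exact ⟨G, hG, hGE, by rwa [Submodule.span_singleton_le_iff_mem]⟩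
  | sup A B hA hB ihA ihB =>
    obtain ⟨G, hG, hGE, hx⟩ := ihA (le_sup_left.trans h)
    obtain ⟨H, hH, hHE, hy⟩ := ihB (le_sup_right.trans h)
    exact ⟨G ⊔ H, hG.sup hH, sup_le hGE hHE,
      sup_le (hx.trans (s.star_mono _ _ le_sup_left)) (hy.trans (s.star_mono _ _ le_sup_right))⟩

theorem smul_finiteTypeStar_le (x : K) (hx : x ≠ 0) (E : Submodule D K) :
    x • s.finiteTypeStar E ≤ s.finiteTypeStar (x • E) := by
  intro y hy
  obtain ⟨z, ⟨F, hF, hFE, hz⟩, rfl⟩ := (Submodule.mem_smul_pointwise_iff_exists _ _ _).1 hy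
  refine ⟨x • F, hF.map _, Submodule.map_mono hFE, ?_⟩
  rw [s.star_smul x hx]
  exact Submodule.smul_mem_pointwise_smul z x _ hz

/-- The finite-type semistar operation `⋆_f` associated with `⋆`. -/
def finiteType : SemistarOperation D K where
  star := s.finiteTypeStar
  star_bot := by
    rw [eq_bot_iff]
    rintro x ⟨F, -, hF, hx⟩
    rw [le_bot_iff] at hF
    rwa [hF, s.star_bot] at hx
  star_smul := by
    intro x hx E
    refine le_antisymm ?_ (s.smul_finiteTypeStar_le x hx E)
    have h := s.smul_finiteTypeStar_le x⁻¹ (inv_ne_zero hx) (x • E)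
    rw [smul_smul, inv_mul_cancel₀ hx, one_smul] at h
    intro y hy
    rw [Submodule.mem_smul_pointwise_iff_exists]
    refine ⟨x⁻¹ • y, h (Submodule.smul_mem_pointwise_smul y x⁻¹ _ hy), ?_⟩
    rw [smul_smul, mul_inv_cancel₀ hx, one_smul]
  star_mono := fun _ _ h => s.finiteTypeStar_mono h
  le_star := s.le_finiteTypeStar
  star_star := by
    intro E
    refine le_antisymm ?_ (s.le_finiteTypeStar _)
    rintro x ⟨F, hF, hFE, hx⟩
    obtain ⟨G, hG, hGE, hFG⟩ := s.exists_fg_of_le_finiteTypeStar hF hFE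
    refine ⟨G, hG, hGE, ?_⟩
    have := s.star_mono _ _ hFG hx
    rwa [s.star_star] at this

/-- `E` is `⋆`-idempotent if `E^⋆ = (E²)^⋆`. -/
def IsStarIdempotent (E : Submodule D K) : Prop := s.star E = s.star (E ^ 2)

/-- A nonzero ideal `I` of `D` is a quasi-`⋆`-ideal if `I = I^⋆ ∩ D`. Here
`IsLocalization.coeSubmodule K I` is `I` regarded as a `D`-submodule of `K`. -/
def IsQuasiStarIdeal (I : Ideal D) : Prop :=
  I ≠ ⊥ ∧ I = (s.star (IsLocalization.coeSubmodule K I)).comap (Algebra.linearMap D K)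

/-- A quasi-`⋆`-prime is a prime quasi-`⋆`-ideal. -/
def IsQuasiStarPrime (P : Ideal D) : Prop := s.IsQuasiStarIdeal P ∧ P.IsPrime

/-- `D` is a Prüfer `⋆`-multiplication domain if `(F F⁻¹)^{⋆_f} = D^{⋆_f}` for all nonzero finitely
generated `D`-submodules `F` of `K`. Here `1` is `D` as a submodule of `K`, and `1 / F` is
`F⁻¹ = (D : F) = {u ∈ K | u F ⊆ D}`. -/
def IsPStarMD : Prop :=
  ∀ F : Submodule D K, F ≠ ⊥ → F.FG → s.finiteType.star (F * (1 / F)) = s.finiteType.star 1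

/-- The multiplicatively closed set `N(⋆) = {g ∈ D[X] | c(g)^⋆ = D^⋆}`. -/
def nagataSubmonoid : Submonoid D[X] where
  carrier := {g | s.star (IsLocalization.coeSubmodule K g.contentIdeal) = s.star 1}
  one_mem' := by
    simp [Polynomial.contentIdeal_one, IsLocalization.coeSubmodule_top]
  mul_mem' := by
    intro f g hf hg
    simp only [Set.mem_ofPred_eq] at hf hg ⊢
    have hle : ∀ I : Ideal D, IsLocalization.coeSubmodule K I ≤ 1 := fun I => by
      rw [← IsLocalization.coeSubmodule_top]
      exact IsLocalization.coeSubmodule_mono K le_top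
    have hmul : ∀ I J : Ideal D,
        s.star 1 ≤ s.star (IsLocalization.coeSubmodule K I) →
        s.star 1 ≤ s.star (IsLocalization.coeSubmodule K J) →
        s.star 1 ≤ s.star (IsLocalization.coeSubmodule K (I * J)) := by
      intro I J hI hJ
      have h1 : (1 : Submodule D K) ≤ s.star (IsLocalization.coeSubmodule K (I * J)) := by
        calc (1 : Submodule D K) = 1 * 1 := (one_mul 1).symm
          _ ≤ s.star (IsLocalization.coeSubmodule K I) * s.star (IsLocalization.coeSubmodule K J) :=
            mul_le_mul' ((s.le_star 1).trans hI) ((s.le_star 1).trans hJ)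
          _ ≤ _ := s.star_mul_star_le _ _
          _ = _ := by rw [IsLocalization.coeSubmodule_mul]
      have h2 := s.star_mono _ _ h1
      rwa [s.star_star] at h2
    have hpow : ∀ (I : Ideal D) (n : ℕ), s.star 1 ≤ s.star (IsLocalization.coeSubmodule K I) →
        s.star 1 ≤ s.star (IsLocalization.coeSubmodule K (I ^ n)) := by
      intro I n hI
      induction n with
      | zero => rw [pow_zero, Ideal.one_eq_top, IsLocalization.coeSubmodule_top]
      | succ n ih => rw [pow_succ]; exact hmul _ _ ih hI
    obtain ⟨n, hn⟩ := Ideal.exists_pow_le_of_le_radical_of_fg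
      (Polynomial.mul_contentIdeal_le_radical_contentIdeal_mul (p := f) (q := g))
      (f.contentIdeal_FG.mul g.contentIdeal_FG)
    refine le_antisymm (s.star_mono _ _ (hle _)) ?_
    exact (hpow _ n (hmul _ _ hf.ge hg.ge)).trans
      (s.star_mono _ _ (IsLocalization.coeSubmodule_mono K hn))

/-- The semistar Nagata ring `Na(D,⋆) = D[X]_{N(⋆)}`. -/
abbrev Nagata : Type _ := Localization s.nagataSubmonoid

end SemistarOperation

/-- A prime ideal `P` is branched if there is a `P`-primary ideal distinct from `P`. -/
def IsBranched {R : Type*} [CommRing R] (P : Ideal R) : Prop :=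
  ∃ Q : Ideal R, Q.IsPrimary ∧ Q.radical = P ∧ Q ≠ P

/-- A Prüfer domain: an integral domain in which every nonzero finitely generated ideal is
invertible. (In particular, fields are Prüfer domains.) -/
structure IsPruferDomain (R : Type*) [CommRing R] : Prop where
  isDomain : IsDomain R
  isUnit_of_fg : ∀ I : Ideal R, I ≠ ⊥ → I.FG → IsUnit (I : FractionalIdeal R⁰ (FractionRing R))

/-- A Prüfer domain is strongly discrete if it has no nonzero idempotent prime ideals. -/
structure IsStronglyDiscretePruferDomain (R : Type*) [CommRing R] : Prop
    extends IsPruferDomain R where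
  not_idempotent : ∀ P : Ideal R, P ≠ ⊥ → P.IsPrime → ¬ IsIdempotentElem P

/-- A Prüfer domain is discrete if it has no nonzero branched idempotent prime ideals. -/
structure IsDiscretePruferDomain (R : Type*) [CommRing R] : Prop
    extends IsPruferDomain R where
  not_idempotent : ∀ P : Ideal R, P ≠ ⊥ → P.IsPrime → IsBranched P → ¬ IsIdempotentElem P

namespace SemistarOperation

variable {D K : Type*} [CommRing D] [Field K] [Algebra D K] (s : SemistarOperation D K)

/-- A P⋆MD is `⋆_f`-strongly discrete if it has no `⋆_f`-idempotent quasi-`⋆_f`-primes. -/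
structure IsStronglyDiscretePStarMD : Prop where
  isPStarMD : s.IsPStarMD
  not_idempotent : ∀ P : Ideal D, s.finiteType.IsQuasiStarPrime P →
    ¬ s.finiteType.IsStarIdempotent (IsLocalization.coeSubmodule K P)

/-- A P⋆MD is `⋆_f`-discrete if it has no branched `⋆_f`-idempotent quasi-`⋆_f`-primes. -/
structure IsDiscretePStarMD : Prop where
  isPStarMD : s.IsPStarMD
  not_idempotent : ∀ P : Ideal D, s.finiteType.IsQuasiStarPrime P → IsBranched P →
    ¬ s.finiteType.IsStarIdempotent (IsLocalization.coeSubmodule K P)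

end SemistarOperation

/-!
An ideal `I` of `D` satisfies `1 ∈ I^{⋆_f}` if and only if it extends to the unit ideal of
`Na(D,⋆)`. Hence `D` is a P⋆MD if and only if the trace ideal `I I⁻¹` of every nonzero finitely
generated ideal `I` extends to the unit ideal.

Let `D` be a P⋆MD, `f ∈ D[X]` and `c ∈ c(f)`. For `u ∈ c(f)⁻¹` the polynomial `h = u f` has
coefficients in `D` and `c h = (c u) f` is a multiple of `f`, while the ideals `c(u f)` add up to
the trace ideal of `c(f)`. Since `c(h) + c(h')` is the content of `h + X^N h'` for large `N`, some
`h` with `c h ∈ f D[X]` is a unit of `Na(D,⋆)`, and `c` is a multiple of `f` there. Thus `f` and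
`c(f)` generate the same ideal, every ideal of `Na(D,⋆)` is extended from `D`, and `Na(D,⋆)` is
Bézout. Moreover `I^{⋆_f} ∩ D = I Na(D,⋆) ∩ D`, so extension and contraction match the
quasi-`⋆_f`-primes of `D` with the nonzero primes of `Na(D,⋆)`, and respect idempotence and
branchedness.

Conversely, if `Na(D,⋆)` is Prüfer and `0 ≠ a ∈ I`, choose `A` with `A I = a Na(D,⋆)`. Clearing
denominators, every element of `A` is, up to a unit, a polynomial `f` with `c(f) I ⊆ a D`; then
`c(f) / a ⊆ I⁻¹` gives `c(f) I ⊆ a I I⁻¹`, and cancelling `a` shows that `I I⁻¹` extends to the unit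
ideal.
-/

section ContentIdeal

open Polynomial

variable {R : Type*} [CommRing R]

theorem contentIdeal_le_iff_mem_map_C {f : R[X]} {I : Ideal R} :
    f.contentIdeal ≤ I ↔ f ∈ I.map C := by
  rw [Ideal.mem_map_C_iff, contentIdeal_def, Ideal.span_le]
  refine ⟨fun h n => ?_, fun h x hx => ?_⟩
  · by_cases h0 : f.coeff n = 0
    · rw [h0]
      exact I.zero_mem
    · exact h (coeff_mem_coeffs h0)
  · obtain ⟨n, -, rfl⟩ := mem_coeffs_iff.1 hx
    exact h n

theorem mem_map_C_contentIdeal (f : R[X]) : f ∈ f.contentIdeal.map C :=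
  contentIdeal_le_iff_mem_map_C.1 le_rfl

theorem contentIdeal_mul_le_iff {f : R[X]} {I J : Ideal R} :
    f.contentIdeal * I ≤ J ↔ Ideal.span {f} * I.map C ≤ J.map C := by
  constructor
  · intro h
    calc Ideal.span {f} * I.map C
        ≤ f.contentIdeal.map C * I.map C := Ideal.mul_mono_left
          ((Ideal.span_singleton_le_iff_mem _).2 (mem_map_C_contentIdeal f))
      _ = (f.contentIdeal * I).map C := (Ideal.map_mul _ _ _).symm
      _ ≤ J.map C := Ideal.map_mono h
  · refine fun h => Ideal.mul_le.2 fun c hc x hx => ?_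
    have hfx : f * C x ∈ J.map C :=
      h (Ideal.mul_mem_mul (Ideal.mem_span_singleton_self f) (Ideal.mem_map_of_mem C hx))
    have hle : f.contentIdeal ≤ J.colon {x} :=
      contentIdeal_le_iff_mem_map_C.2 <| Ideal.mem_map_C_iff.2 fun n => by
        rw [Submodule.mem_colon_singleton, smul_eq_mul, ← coeff_mul_C]
        exact Ideal.mem_map_C_iff.1 hfx n
    exact Submodule.mem_colon_singleton.1 (hle hc)

theorem contentIdeal_add_X_pow_mul {f : R[X]} (g : R[X]) {N : ℕ} (hN : f.natDegree < N) :
    (f + X ^ N * g).contentIdeal = f.contentIdeal ⊔ g.contentIdeal := by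
  have coeff_low : ∀ n < N, (f + X ^ N * g).coeff n = f.coeff n := fun n hn => by
    rw [coeff_add, coeff_X_pow_mul', if_neg (by lia), add_zero]
  have coeff_high : ∀ n, (f + X ^ N * g).coeff (n + N) = g.coeff n := fun n => by
    rw [coeff_add, coeff_X_pow_mul, coeff_eq_zero_of_natDegree_lt (by lia), zero_add]
  refine le_antisymm ?_ (sup_le ?_ ?_) <;> rw [contentIdeal_le_iff_mem_map_C, Ideal.mem_map_C_iff]
  · intro n
    rcases lt_or_ge n N with hn | hn
    · rw [coeff_low n hn]
      exact Ideal.mem_sup_left (f.coeff_mem_contentIdeal n)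
    · obtain ⟨m, rfl⟩ := Nat.exists_eq_add_of_le' hn
      rw [coeff_high]
      exact Ideal.mem_sup_right (g.coeff_mem_contentIdeal m)
  · intro n
    rcases lt_or_ge n N with hn | hn
    · rw [← coeff_low n hn]
      exact coeff_mem_contentIdeal _ n
    · rw [coeff_eq_zero_of_natDegree_lt (by lia)]
      exact Ideal.zero_mem _
  · intro n
    rw [← coeff_high]
    exact coeff_mem_contentIdeal _ _

theorem exists_mem_le_contentIdeal_of_fg {H : Ideal R[X]} {J : Ideal R} (hJ : J.FG)
    (hJH : J ≤ sSup (contentIdeal '' H)) : ∃ h ∈ H, J ≤ h.contentIdeal := by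
  have directed : DirectedOn (· ≤ ·) (contentIdeal '' (H : Set R[X])) := by
    rintro _ ⟨f, hf, rfl⟩ _ ⟨g, hg, rfl⟩
    have hsup := contentIdeal_add_X_pow_mul g (Nat.lt_succ_self f.natDegree)
    exact ⟨_, ⟨_, H.add_mem hf (H.mul_mem_left _ hg), rfl⟩,
      le_sup_left.trans hsup.ge, le_sup_right.trans hsup.ge⟩
  obtain ⟨_, ⟨h, hH, rfl⟩, hle⟩ :=
    (CompleteLattice.isCompactElement_iff_le_of_directed_sSup_le _ J).1
      ((Submodule.fg_iff_compact J).1 hJ) _ ⟨_, Set.mem_image_of_mem _ H.zero_mem⟩ directed hJH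
  exact ⟨h, hH, hle⟩

theorem exists_contentIdeal_eq_of_fg {J : Ideal R} (hJ : J.FG) :
    ∃ g : R[X], g.contentIdeal = J := by
  obtain ⟨g, hg, hJg⟩ := exists_mem_le_contentIdeal_of_fg (H := J.map C) hJ fun x hx =>
    le_sSup (Set.mem_image_of_mem contentIdeal (Ideal.mem_map_of_mem C hx))
      (by simp)
  exact ⟨g, le_antisymm (contentIdeal_le_iff_mem_map_C.2 hg) hJg⟩

end ContentIdeal

section Localization

variable {R : Type*} [CommRing R] (M : Submonoid R) {S : Type*} [CommRing S] [Algebra R S]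
  [IsLocalization M S]

include M in
theorem exists_span_singleton_eq_span_algebraMap (z : S) :
    ∃ r : R, Ideal.span {z} = Ideal.span {algebraMap R S r} := by
  obtain ⟨⟨r, m⟩, h⟩ := IsLocalization.surj M z
  exact ⟨r, by rw [← h, Ideal.span_singleton_mul_right_unit (IsLocalization.map_units S m)]⟩

variable {M} in
theorem span_algebraMap_eq_top {m : R} (hm : m ∈ M) : Ideal.span {algebraMap R S m} = ⊤ :=
  Ideal.span_singleton_eq_top.2 (IsLocalization.map_units S (⟨m, hm⟩ : M))

theorem map_algebraMap_le_map_iff_of_fg {I J : Ideal R} (hI : I.FG) :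
    I.map (algebraMap R S) ≤ J.map (algebraMap R S) ↔ ∃ m ∈ M, Ideal.span {m} * I ≤ J := by
  constructor
  · intro h
    induction I, hI using Submodule.fg_induction with
    | singleton x =>
      obtain ⟨m, hm, hmx⟩ := (IsLocalization.algebraMap_mem_map_algebraMap_iff M S J x).1
        (h (Ideal.mem_map_of_mem _ (Ideal.mem_span_singleton_self x)))
      refine ⟨m, hm, ?_⟩
      rwa [Ideal.submodule_span_eq, Ideal.span_singleton_mul_span_singleton,
        Ideal.span_singleton_le_iff_mem]
    | sup A B _ _ ihA ihB =>
      obtain ⟨m, hm, hA⟩ := ihA ((Ideal.map_mono le_sup_left).trans h)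
      obtain ⟨n, hn, hB⟩ := ihB ((Ideal.map_mono le_sup_right).trans h)
      refine ⟨m * n, mul_mem hm hn, ?_⟩
      rw [← Ideal.span_singleton_mul_span_singleton]
      refine (Ideal.mul_sup _ _ _).trans_le (sup_le ?_ ?_)
      · exact (Ideal.mul_mono_left Ideal.mul_le_left).trans hA
      · exact (Ideal.mul_mono_left Ideal.mul_le_right).trans hB
  · rintro ⟨m, hm, h⟩
    calc I.map (algebraMap R S)
        = (Ideal.span {m} * I).map (algebraMap R S) := by
          rw [Ideal.map_mul, Ideal.map_span, Set.image_singleton, span_algebraMap_eq_top hm,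
            Ideal.top_mul]
      _ ≤ J.map (algebraMap R S) := Ideal.map_mono h

end Localization

theorem IsBranched.comap {R S : Type*} [CommRing R] [CommRing S] {φ : R →+* S}
    (hφ : ∀ I : Ideal S, (I.comap φ).map φ = I) {P : Ideal S} (hP : IsBranched P) :
    IsBranched (P.comap φ) := by
  obtain ⟨Q, hQ, hQP, hne⟩ := hP
  refine ⟨Q.comap φ, hQ.comap φ, by rw [← Ideal.comap_radical, hQP], fun h => hne ?_⟩
  rw [← hφ Q, h, hφ]

theorem le_or_le_radical_of_mul_le {R : Type*} [CommRing R] {A B J : Ideal R} (hJ : J.IsPrimary)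
    (h : A * B ≤ J) : A ≤ J ∨ B ≤ J.radical := by
  by_contra! hAB
  obtain ⟨a, ha, haJ⟩ := SetLike.not_le_iff_exists.1 hAB.1
  obtain ⟨b, hb, hbJ⟩ := SetLike.not_le_iff_exists.1 hAB.2
  exact ((Ideal.isPrimary_iff.1 hJ).2 (h (Ideal.mul_mem_mul ha hb))).elim haJ hbJ

section ExtendedIdeals

variable {R S : Type*} [CommRing R] [CommRing S] {φ : R →+* S}
  (hφ : ∀ I : Ideal S, (I.comap φ).map φ = I) {J : Ideal R} (hJ : (J.map φ).comap φ = J)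

include hφ hJ

theorem radical_map_eq_map_radical : (J.map φ).radical = J.radical.map φ := by
  rw [← hφ (J.map φ).radical, Ideal.comap_radical, hJ]

theorem isPrimary_map (hJp : J.IsPrimary) : (J.map φ).IsPrimary := by
  refine Ideal.isPrimary_iff.2 ⟨fun h => hJp.ne_top ?_, fun {z w} hzw => ?_⟩
  · rw [← hJ, h, Ideal.comap_top]
  have hmul : (Ideal.span {z}).comap φ * (Ideal.span {w}).comap φ ≤ J := by
    rw [← hJ, ← Ideal.map_le_iff_le_comap, Ideal.map_mul, hφ, hφ,
      Ideal.span_singleton_mul_span_singleton]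
    exact (Ideal.span_singleton_le_iff_mem _).2 hzw
  refine (le_or_le_radical_of_mul_le hJp hmul).imp (fun h => ?_) (fun h => ?_)
  · rw [← Ideal.span_singleton_le_iff_mem, ← hφ (Ideal.span {z})]
    exact Ideal.map_mono h
  · rw [radical_map_eq_map_radical hφ hJ, ← Ideal.span_singleton_le_iff_mem,
      ← hφ (Ideal.span {w})]
    exact Ideal.map_mono h

theorem isPrime_map (hJp : J.IsPrime) : (J.map φ).IsPrime := by
  have hrad : (J.map φ).radical = J.map φ := by
    rw [radical_map_eq_map_radical hφ hJ, hJp.radical]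
  exact hrad ▸ Ideal.isPrime_radical (isPrimary_map hφ hJ hJp.isPrimary)

end ExtendedIdeals

section PruferDomain

theorem IsPruferDomain.exists_mul_eq_span_singleton {R : Type*} [CommRing R]
    (hR : IsPruferDomain R) {I : Ideal R} (hI : I.FG) {x : R} (hx : x ∈ I) :
    ∃ J : Ideal R, I * J = Ideal.span {x} := by
  have := hR.isDomain
  obtain rfl | hI0 := eq_or_ne I ⊥
  · rw [Ideal.mem_bot] at hx
    exact ⟨⊥, by simp [hx]⟩
  obtain ⟨u, hu⟩ := hR.isUnit_of_fg I hI0 hI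
  have hle : (u⁻¹.val * (Ideal.span {x} : Ideal R) : FractionalIdeal R⁰ (FractionRing R)) ≤ 1 := by
    rw [← Units.inv_mul u, hu]
    refine mul_le_mul' le_rfl ((FractionalIdeal.coeIdeal_le_coeIdeal _).2 ?_)
    rwa [Ideal.span_singleton_le_iff_mem]
  obtain ⟨J, hJ⟩ := FractionalIdeal.le_one_iff_exists_coeIdeal.1 hle
  refine ⟨J, FractionalIdeal.coeIdeal_injective (K := FractionRing R) ?_⟩
  change ((I * J : Ideal R) : FractionalIdeal R⁰ (FractionRing R)) = _
  rw [FractionalIdeal.coeIdeal_mul, hJ, ← hu, Units.mul_inv_cancel_left]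

theorem IsPruferDomain.of_isBezout (R : Type*) [CommRing R] [IsDomain R] [IsBezout R] :
    IsPruferDomain R where
  isDomain := inferInstance
  isUnit_of_fg I hI hfg := by
    obtain ⟨x, rfl⟩ := (IsBezout.isPrincipal_of_FG I hfg).principal
    have hx : x ≠ 0 := by
      rintro rfl
      simp at hI
    exact IsUnit.of_mul_eq_one _
      (FractionalIdeal.coe_ideal_span_singleton_mul_inv (FractionRing R) hx)

end PruferDomain

section TraceIdeal

open Polynomial IsLocalization

variable {D K : Type*} [CommRing D] [Field K] [Algebra D K]

theorem coeSubmodule_le_one (I : Ideal D) : coeSubmodule K I ≤ 1 := by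
  rw [← coeSubmodule_top]
  exact coeSubmodule_mono K le_top

theorem coeSubmodule_comap_linearMap {E : Submodule D K} (hE : E ≤ 1) :
    coeSubmodule K (E.comap (Algebra.linearMap D K) : Ideal D) = E := by
  rw [coeSubmodule, Submodule.map_comap_eq, ← Submodule.one_eq_range]
  exact inf_eq_right.2 hE

/-- The trace ideal `F F⁻¹` of a `D`-submodule `F` of `K`, where `F⁻¹ = (D : F)`. It is contained in
`D`, and is encoded as an ideal of `D` rather than as a submodule of `K` so that it can be extended
to the Nagata ring. -/
def traceIdeal (F : Submodule D K) : Ideal D :=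
  (F * (1 / F)).comap (Algebra.linearMap D K)

theorem coeSubmodule_traceIdeal (F : Submodule D K) :
    coeSubmodule K (traceIdeal F) = F * (1 / F) :=
  coeSubmodule_comap_linearMap Submodule.mul_one_div_le_one

theorem traceIdeal_smul {x : K} (hx : x ≠ 0) (F : Submodule D K) :
    traceIdeal (x • F) = traceIdeal F := by
  have le_smul : ∀ (y : K) (_ : y ≠ 0) (G : Submodule D K), traceIdeal G ≤ traceIdeal (y • G) := by
    refine fun y hy G => Submodule.comap_mono (Submodule.mul_le.2 fun a ha u hu => ?_)
    rw [show a * u = y • a * (y⁻¹ * u) by rw [smul_eq_mul]; field_simp]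
    refine Submodule.mul_mem_mul (Submodule.smul_mem_pointwise_smul a y G ha) ?_
    refine Submodule.mem_div_iff_forall_mul_mem.2 fun z hz => ?_
    obtain ⟨b, hb, rfl⟩ := (Submodule.mem_smul_pointwise_iff_exists _ _ _).1 hz
    rw [show y⁻¹ * u * y • b = u * b by rw [smul_eq_mul]; field_simp]
    exact Submodule.mem_div_iff_forall_mul_mem.1 hu b hb
  refine le_antisymm ?_ (le_smul x hx F)
  simpa only [inv_smul_smul₀ hx] using le_smul x⁻¹ (inv_ne_zero hx) (x • F)

theorem exists_map_eq_C_mul_map {f : D[X]} {u : K}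
    (hu : u ∈ (1 : Submodule D K) / coeSubmodule K f.contentIdeal) :
    ∃ h : D[X], h.map (algebraMap D K) = C u * f.map (algebraMap D K) := by
  refine (mem_lifts _).1 ((lifts_iff_coeff_lifts _).2 fun n => ?_)
  rw [coeff_C_mul, coeff_map]
  exact Submodule.mem_one.1 (Submodule.mem_div_iff_forall_mul_mem.1 hu _
    ⟨_, f.coeff_mem_contentIdeal n, rfl⟩)

variable [IsFractionRing D K]

theorem exists_coeSubmodule_eq_smul_of_fg {F : Submodule D K} (hF : F.FG) :
    ∃ x : K, x ≠ 0 ∧ ∃ I : Ideal D, I.FG ∧ coeSubmodule K I = x • F := by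
  obtain ⟨a, ha, haF⟩ := FractionalIdeal.isFractional_of_fg (S := D⁰) hF
  have hle : algebraMap D K a • F ≤ 1 := by
    intro y hy
    obtain ⟨b, hb, rfl⟩ := (Submodule.mem_smul_pointwise_iff_exists _ _ _).1 hy
    obtain ⟨d, hd⟩ := haF b hb
    rw [smul_eq_mul, ← Algebra.smul_def, ← hd]
    exact Submodule.algebraMap_mem d
  have hI := coeSubmodule_comap_linearMap hle
  refine ⟨_, (map_units K (⟨a, ha⟩ : D⁰)).ne_zero, _, ?_, hI⟩
  refine (coeSubmodule_fg K (IsFractionRing.injective D K) _).1 ?_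
  rw [hI]
  exact hF.map _

theorem mul_le_span_singleton_mul_traceIdeal {B I : Ideal D} {a : D} (ha : a ≠ 0)
    (h : B * I ≤ Ideal.span {a}) : B * I ≤ Ideal.span {a} * traceIdeal (coeSubmodule K I) := by
  refine Ideal.mul_le.2 fun b hb y hy => ?_
  have ha' : algebraMap D K a ≠ 0 := by
    rwa [Ne, IsFractionRing.to_map_eq_zero_iff]
  have hu : algebraMap D K b / algebraMap D K a ∈ (1 : Submodule D K) / coeSubmodule K I := by
    refine Submodule.mem_div_iff_forall_mul_mem.2 ?_
    rintro _ ⟨z, hz, rfl⟩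
    obtain ⟨d, hd⟩ := Ideal.mem_span_singleton.1 (h (Ideal.mul_mem_mul hb hz))
    refine Submodule.mem_one.2 ⟨d, ?_⟩
    rw [Algebra.linearMap_apply, div_mul_eq_mul_div, ← map_mul, hd, map_mul,
      mul_div_cancel_left₀ _ ha']
  obtain ⟨d, hd⟩ := Ideal.mem_span_singleton.1 (h (Ideal.mul_mem_mul hb hy))
  rw [hd, Ideal.mem_span_singleton_mul]
  refine ⟨d, ?_, rfl⟩
  have hdu : algebraMap D K d = algebraMap D K y * (algebraMap D K b / algebraMap D K a) := by
    rw [mul_div_assoc', eq_div_iff ha', ← map_mul, ← map_mul, mul_comm y b, hd, mul_comm]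
  change algebraMap D K d ∈ coeSubmodule K I * (1 / coeSubmodule K I)
  rw [hdu]
  exact Submodule.mul_mem_mul ⟨y, hy, rfl⟩ hu

theorem traceIdeal_contentIdeal_le {f : D[X]} {c : D} (hc : c ∈ f.contentIdeal) :
    traceIdeal (coeSubmodule K f.contentIdeal) ≤
      sSup (contentIdeal '' ((Ideal.span {f}).colon {C c} : Set D[X])) := by
  rw [← coeSubmodule_le_coeSubmodule (S := K) le_rfl, coeSubmodule_traceIdeal, mul_comm,
    Submodule.mul_le]
  rintro u hu _ ⟨y, hy, rfl⟩
  obtain ⟨h, hh⟩ := exists_map_eq_C_mul_map hu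
  obtain ⟨d, hd⟩ := Submodule.mem_one.1
    (Submodule.mem_div_iff_forall_mul_mem.1 hu _ ⟨c, hc, rfl⟩)
  have hmem : h ∈ (Ideal.span {f}).colon {C c} := by
    refine Submodule.mem_colon_singleton.2 (Ideal.mem_span_singleton.2 ⟨C d, ?_⟩)
    refine map_injective _ (IsFractionRing.injective D K) ?_
    rw [smul_eq_mul, Polynomial.map_mul, Polynomial.map_mul, hh, map_C, map_C, hd, C_mul,
      Algebra.linearMap_apply]
    ring
  refine coeSubmodule_mono K (le_sSup (Set.mem_image_of_mem _ hmem)) ?_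
  suffices f.contentIdeal ≤
      (coeSubmodule K h.contentIdeal).comap (u • Algebra.linearMap D K) from this hy
  rw [contentIdeal_def, Ideal.span_le]
  intro a ha
  obtain ⟨n, -, rfl⟩ := mem_coeffs_iff.1 ha
  refine ⟨h.coeff n, h.coeff_mem_contentIdeal n, ?_⟩
  rw [Algebra.linearMap_apply, ← coeff_map, hh, coeff_C_mul, coeff_map]
  rfl

end TraceIdeal

namespace SemistarOperation

open Polynomial IsLocalization

variable {D K : Type*} [CommRing D] [Field K] [Algebra D K] (s : SemistarOperation D K)

section Star

theorem star_le_iff {E F : Submodule D K} : s.star E ≤ s.star F ↔ E ≤ s.star F := by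
  refine ⟨(s.le_star E).trans, fun h => ?_⟩
  simpa only [s.star_star] using s.star_mono _ _ h

theorem star_eq_star_one_iff {E : Submodule D K} (hE : E ≤ 1) :
    s.star E = s.star 1 ↔ (1 : K) ∈ s.star E := by
  rw [← Submodule.one_le, ← s.star_le_iff]
  exact ⟨fun h => h.ge, fun h => le_antisymm (s.star_mono _ _ hE) h⟩

theorem mem_nagataSubmonoid {g : D[X]} :
    g ∈ s.nagataSubmonoid ↔ (1 : K) ∈ s.star (coeSubmodule K g.contentIdeal) :=
  s.star_eq_star_one_iff (coeSubmodule_le_one _)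

variable {s} in
theorem mem_nagataSubmonoid_of_contentIdeal_le {g h : D[X]} (hg : g ∈ s.nagataSubmonoid)
    (hgh : g.contentIdeal ≤ h.contentIdeal) : h ∈ s.nagataSubmonoid :=
  s.mem_nagataSubmonoid.2
    (s.star_mono _ _ (coeSubmodule_mono K hgh) (s.mem_nagataSubmonoid.1 hg))

theorem nagataSubmonoid_le_nonZeroDivisors [IsDomain D] : s.nagataSubmonoid ≤ D[X]⁰ := by
  refine fun g hg => mem_nonZeroDivisors_of_ne_zero ?_
  rintro rfl
  simpa [s.star_bot] using s.mem_nagataSubmonoid.1 hg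

theorem mem_finiteType_coeSubmodule [IsFractionRing D K] {I : Ideal D} {x : K} :
    x ∈ s.finiteType.star (coeSubmodule K I) ↔
      ∃ J : Ideal D, J.FG ∧ J ≤ I ∧ x ∈ s.star (coeSubmodule K J) := by
  constructor
  · rintro ⟨F, hF, hFI, hx⟩
    have hJ := coeSubmodule_comap_linearMap (hFI.trans (coeSubmodule_le_one I))
    rw [← hJ] at hF hFI hx
    exact ⟨_, (coeSubmodule_fg K (IsFractionRing.injective D K) _).1 hF,
      (coeSubmodule_le_coeSubmodule le_rfl).1 hFI, hx⟩
  · rintro ⟨J, hJ, hJI, hx⟩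
    exact ⟨_, Submodule.FG.map _ hJ, coeSubmodule_mono K hJI, hx⟩

theorem isPStarMD_iff_one_mem [IsFractionRing D K] :
    s.IsPStarMD ↔ ∀ I : Ideal D, I ≠ ⊥ → I.FG →
      (1 : K) ∈ s.finiteType.star (coeSubmodule K (traceIdeal (coeSubmodule K I))) := by
  simp only [IsPStarMD, s.finiteType.star_eq_star_one_iff Submodule.mul_one_div_le_one]
  simp only [← coeSubmodule_traceIdeal]
  constructor
  · intro h I hI hfg
    refine h _ (fun hbot => hI ?_) (Submodule.FG.map _ hfg)
    exact coeSubmodule_injective K le_rfl (hbot.trans (coeSubmodule_bot K).symm)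
  · intro h F hF hfg
    obtain ⟨x, hx, I, hI, hIF⟩ := exists_coeSubmodule_eq_smul_of_fg hfg
    rw [← traceIdeal_smul hx, ← hIF]
    refine h I ?_ hI
    rintro rfl
    refine hF ?_
    rw [coeSubmodule_bot] at hIF
    simpa only [inv_smul_smul₀ hx, Submodule.smul_bot'] using congrArg (x⁻¹ • ·) hIF.symm

end Star

section Nagata

/-- The canonical homomorphism from `D` to its Nagata ring, along which ideals are extended and
contracted. -/
noncomputable def toNagata : D →+* s.Nagata := (algebraMap D[X] s.Nagata).comp C

theorem map_toNagata (I : Ideal D) :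
    I.map s.toNagata = (I.map C).map (algebraMap D[X] s.Nagata) :=
  (Ideal.map_map C _).symm

theorem isDomain_nagata [IsDomain D] : IsDomain s.Nagata :=
  isDomain_localization s.nagataSubmonoid_le_nonZeroDivisors

theorem toNagata_injective [IsDomain D] : Function.Injective s.toNagata :=
  (IsLocalization.injective s.Nagata s.nagataSubmonoid_le_nonZeroDivisors).comp C_injective

theorem span_algebraMap_mul_map_toNagata_le_iff {f : D[X]} {I J : Ideal D} (hI : I.FG) :
    Ideal.span {algebraMap D[X] s.Nagata f} * I.map s.toNagata ≤ J.map s.toNagata ↔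
      ∃ g ∈ s.nagataSubmonoid, (g * f).contentIdeal * I ≤ J := by
  have hfg : (Ideal.span {f} * I.map C).FG :=
    (Submodule.fg_span_singleton f).mul (Ideal.FG.map hI C)
  have hspan : Ideal.span {algebraMap D[X] s.Nagata f} * I.map s.toNagata =
      (Ideal.span {f} * I.map C).map (algebraMap D[X] s.Nagata) := by
    rw [Ideal.map_mul, Ideal.map_span, Set.image_singleton, map_toNagata]
  rw [hspan, map_toNagata, map_algebraMap_le_map_iff_of_fg s.nagataSubmonoid hfg]
  simp only [contentIdeal_mul_le_iff, ← mul_assoc, Ideal.span_singleton_mul_span_singleton]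

theorem map_toNagata_le_map_iff {I J : Ideal D} (hI : I.FG) :
    I.map s.toNagata ≤ J.map s.toNagata ↔
      ∃ g ∈ s.nagataSubmonoid, g.contentIdeal * I ≤ J := by
  simpa only [map_one, Ideal.span_singleton_one, Ideal.top_mul, mul_one] using
    s.span_algebraMap_mul_map_toNagata_le_iff (f := 1) (J := J) hI

theorem map_toNagata_eq_top_iff {I : Ideal D} :
    I.map s.toNagata = ⊤ ↔ ∃ g ∈ s.nagataSubmonoid, g.contentIdeal ≤ I := by
  simpa only [Ideal.map_top, top_le_iff, Ideal.mul_top] using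
    s.map_toNagata_le_map_iff (I := ⊤) (J := I) (Submodule.FG.of_finite)

theorem toNagata_mem_map_iff {I : Ideal D} {x : D} :
    s.toNagata x ∈ I.map s.toNagata ↔
      ∃ g ∈ s.nagataSubmonoid, g.contentIdeal * Ideal.span {x} ≤ I := by
  rw [← s.map_toNagata_le_map_iff (Submodule.fg_span_singleton x), Ideal.map_span,
    Set.image_singleton, Ideal.span_singleton_le_iff_mem]

theorem comap_map_toNagata {J : Ideal D} (hJ : J.IsPrimary) (h : J.radical.map s.toNagata ≠ ⊤) :
    (J.map s.toNagata).comap s.toNagata = J := by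
  refine le_antisymm (fun x hx => ?_) Ideal.le_comap_map
  obtain ⟨g, hg, hgx⟩ := s.toNagata_mem_map_iff.1 hx
  rw [mul_comm] at hgx
  refine (Ideal.span_singleton_le_iff_mem _).1 ((le_or_le_radical_of_mul_le hJ hgx).resolve_right
    fun hle => h (s.map_toNagata_eq_top_iff.2 ⟨g, hg, hle⟩))

variable [IsFractionRing D K]

theorem one_mem_finiteType_iff_map_eq_top {I : Ideal D} :
    (1 : K) ∈ s.finiteType.star (coeSubmodule K I) ↔ I.map s.toNagata = ⊤ := by
  rw [mem_finiteType_coeSubmodule, map_toNagata_eq_top_iff]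
  constructor
  · rintro ⟨J, hJ, hJI, h⟩
    obtain ⟨g, rfl⟩ := exists_contentIdeal_eq_of_fg hJ
    exact ⟨g, s.mem_nagataSubmonoid.2 h, hJI⟩
  · rintro ⟨g, hg, hgI⟩
    exact ⟨_, g.contentIdeal_FG, hgI, s.mem_nagataSubmonoid.1 hg⟩

theorem isPStarMD_iff_map_traceIdeal_eq_top :
    s.IsPStarMD ↔ ∀ I : Ideal D, I ≠ ⊥ → I.FG →
      (traceIdeal (coeSubmodule K I)).map s.toNagata = ⊤ := by
  simp only [isPStarMD_iff_one_mem, one_mem_finiteType_iff_map_eq_top]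

theorem comap_map_toNagata_le (I : Ideal D) :
    (I.map s.toNagata).comap s.toNagata ≤
      (s.finiteType.star (coeSubmodule K I)).comap (Algebra.linearMap D K) := by
  intro x hx
  obtain ⟨g, hg, hgx⟩ := s.toNagata_mem_map_iff.1 hx
  have one_mem : (1 : K) ∈ s.finiteType.star (coeSubmodule K g.contentIdeal) :=
    s.one_mem_finiteType_iff_map_eq_top.2 (s.map_toNagata_eq_top_iff.2 ⟨g, hg, le_rfl⟩)
  have x_mem : algebraMap D K x ∈ s.finiteType.star (coeSubmodule K (Ideal.span {x})) :=
    s.finiteType.le_star _ ⟨x, Ideal.mem_span_singleton_self x, rfl⟩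
  rw [Submodule.mem_comap, Algebra.linearMap_apply, ← one_mul (algebraMap D K x)]
  refine s.finiteType.star_mono _ _ (coeSubmodule_mono K hgx) ?_
  rw [coeSubmodule_mul]
  exact s.finiteType.star_mul_star_le _ _ (Submodule.mul_mem_mul one_mem x_mem)

end Nagata

section PStarMD

variable [IsFractionRing D K] {s}

theorem IsPStarMD.map_le_map_of_coeSubmodule_le_star (hs : s.IsPStarMD) {I J : Ideal D}
    (hI : I.FG) (hJI : J ≤ I) (h : coeSubmodule K I ≤ s.finiteType.star (coeSubmodule K J)) :
    I.map s.toNagata ≤ J.map s.toNagata := by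
  obtain rfl | hI0 := eq_or_ne I ⊥
  · rw [Ideal.map_bot]
    exact bot_le
  have hJ : coeSubmodule K J * (1 / coeSubmodule K I) ≤ 1 :=
    (mul_le_mul' (coeSubmodule_mono K hJI) le_rfl).trans Submodule.mul_one_div_le_one
  have one_mem : (1 : K) ∈ s.finiteType.star (coeSubmodule K J * (1 / coeSubmodule K I)) := by
    have hI1 := s.isPStarMD_iff_one_mem.1 hs I hI0 hI
    rw [coeSubmodule_traceIdeal] at hI1
    refine s.finiteType.star_le_iff.2 ?_ hI1
    exact (mul_le_mul' h (s.finiteType.le_star _)).trans (s.finiteType.star_mul_star_le _ _)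
  rw [← coeSubmodule_comap_linearMap hJ, one_mem_finiteType_iff_map_eq_top,
    map_toNagata_eq_top_iff] at one_mem
  obtain ⟨g, hg, hgJ⟩ := one_mem
  refine (s.map_toNagata_le_map_iff hI).2 ⟨g, hg, ?_⟩
  rw [← coeSubmodule_le_coeSubmodule (S := K) le_rfl, coeSubmodule_mul]
  calc coeSubmodule K g.contentIdeal * coeSubmodule K I
      ≤ coeSubmodule K J * (1 / coeSubmodule K I) * coeSubmodule K I :=
        mul_le_mul' ((coeSubmodule_mono K hgJ).trans_eq (coeSubmodule_comap_linearMap hJ)) le_rfl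
    _ ≤ coeSubmodule K J * 1 := by
        rw [mul_assoc, mul_comm (1 / _)]
        exact mul_le_mul' le_rfl Submodule.mul_one_div_le_one
    _ = coeSubmodule K J := mul_one _

theorem IsPStarMD.comap_star_coeSubmodule (hs : s.IsPStarMD) (I : Ideal D) :
    (s.finiteType.star (coeSubmodule K I)).comap (Algebra.linearMap D K) =
      (I.map s.toNagata).comap s.toNagata := by
  refine le_antisymm (fun x hx => ?_) (s.comap_map_toNagata_le I)
  obtain ⟨J, hJ, hJI, hxJ⟩ := s.mem_finiteType_coeSubmodule.1 hx
  have hle : coeSubmodule K (J ⊔ Ideal.span {x}) ≤ s.finiteType.star (coeSubmodule K J) := by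
    rw [coeSubmodule_sup, coeSubmodule_span_singleton]
    exact sup_le (s.finiteType.le_star _) ((Submodule.span_singleton_le_iff_mem _ _).2
      (s.mem_finiteType_coeSubmodule.2 ⟨J, hJ, le_rfl, hxJ⟩))
  exact Ideal.map_mono hJI <| hs.map_le_map_of_coeSubmodule_le_star
    (Submodule.FG.sup hJ (Submodule.fg_span_singleton x)) le_sup_left hle <|
    Ideal.mem_map_of_mem _ (Ideal.mem_sup_right (Ideal.mem_span_singleton_self x))

theorem IsPStarMD.star_coeSubmodule_le_iff (hs : s.IsPStarMD) {I J : Ideal D} :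
    s.finiteType.star (coeSubmodule K I) ≤ s.finiteType.star (coeSubmodule K J) ↔
      I.map s.toNagata ≤ J.map s.toNagata := by
  rw [star_le_iff, coeSubmodule, Submodule.map_le_iff_le_comap, hs.comap_star_coeSubmodule,
    Ideal.map_le_iff_le_comap]

theorem IsPStarMD.isStarIdempotent_iff (hs : s.IsPStarMD) {I : Ideal D} :
    s.finiteType.IsStarIdempotent (coeSubmodule K I) ↔ IsIdempotentElem (I.map s.toNagata) := by
  rw [IsStarIdempotent, pow_two, ← coeSubmodule_mul, le_antisymm_iff, hs.star_coeSubmodule_le_iff,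
    hs.star_coeSubmodule_le_iff, ← le_antisymm_iff, Ideal.map_mul, eq_comm, IsIdempotentElem]

theorem IsPStarMD.map_contentIdeal (hs : s.IsPStarMD) (f : D[X]) :
    f.contentIdeal.map s.toNagata = Ideal.span {algebraMap D[X] s.Nagata f} := by
  refine le_antisymm (Ideal.map_le_iff_le_comap.2 fun c hc => ?_) ?_
  · obtain rfl | hc0 := eq_or_ne c 0
    · exact Ideal.zero_mem _
    have hf : f.contentIdeal ≠ ⊥ := fun h => hc0 (by simpa [h] using hc)
    obtain ⟨g, hg, hgf⟩ := s.map_toNagata_eq_top_iff.1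
      (s.isPStarMD_iff_map_traceIdeal_eq_top.1 hs _ hf f.contentIdeal_FG)
    obtain ⟨h, hh, hgh⟩ := exists_mem_le_contentIdeal_of_fg g.contentIdeal_FG
      (hgf.trans (traceIdeal_contentIdeal_le hc))
    have hdvd : algebraMap D[X] s.Nagata f ∣ algebraMap D[X] s.Nagata h * s.toNagata c := by
      have := map_dvd (algebraMap D[X] s.Nagata)
        (Ideal.mem_span_singleton.1 (Submodule.mem_colon_singleton.1 hh))
      rwa [smul_eq_mul, map_mul] at this
    have hunit := map_units s.Nagata
      (⟨h, mem_nagataSubmonoid_of_contentIdeal_le hg hgh⟩ : s.nagataSubmonoid)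
    exact Ideal.mem_span_singleton.2 (hunit.dvd_mul_left.1 hdvd)
  · rw [Ideal.span_singleton_le_iff_mem, map_toNagata]
    exact Ideal.mem_map_of_mem _ (mem_map_C_contentIdeal f)

theorem IsPStarMD.map_comap_toNagata (hs : s.IsPStarMD) (I : Ideal s.Nagata) :
    (I.comap s.toNagata).map s.toNagata = I := by
  refine le_antisymm Ideal.map_comap_le fun z hz => ?_
  obtain ⟨f, hf⟩ := exists_span_singleton_eq_span_algebraMap s.nagataSubmonoid z
  have hspan : Ideal.span {z} = f.contentIdeal.map s.toNagata := by
    rw [hs.map_contentIdeal, hf]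
  rw [← Ideal.span_singleton_le_iff_mem, hspan] at hz ⊢
  exact Ideal.map_mono (Ideal.map_le_iff_le_comap.1 hz)

theorem IsPStarMD.isBezout_nagata (hs : s.IsPStarMD) : IsBezout s.Nagata := by
  refine IsBezout.iff_span_pair_isPrincipal.2 fun x y => ?_
  obtain ⟨f, hf⟩ := exists_span_singleton_eq_span_algebraMap s.nagataSubmonoid x
  obtain ⟨g, hg⟩ := exists_span_singleton_eq_span_algebraMap s.nagataSubmonoid y
  obtain ⟨h, hh⟩ := exists_contentIdeal_eq_of_fg
    (Submodule.FG.sup f.contentIdeal_FG g.contentIdeal_FG)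
  refine ⟨algebraMap D[X] s.Nagata h, ?_⟩
  rw [Ideal.submodule_span_eq, Ideal.span_insert, hf, hg,
    ← hs.map_contentIdeal, ← hs.map_contentIdeal, ← hs.map_contentIdeal, ← Ideal.map_sup, hh]

theorem mul_map_toNagata_le_span_singleton_mul_map_traceIdeal {I : Ideal D} (hI : I.FG) {a : D}
    (ha : a ≠ 0) {A : Ideal s.Nagata} (h : A * I.map s.toNagata ≤ Ideal.span {s.toNagata a}) :
    A * I.map s.toNagata ≤
      Ideal.span {s.toNagata a} * (traceIdeal (coeSubmodule K I)).map s.toNagata := by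
  refine Ideal.mul_le.2 fun z hz w hw => ?_
  obtain ⟨f, hf⟩ := exists_span_singleton_eq_span_algebraMap s.nagataSubmonoid z
  have hfI : Ideal.span {algebraMap D[X] s.Nagata f} * I.map s.toNagata ≤
      (Ideal.span {a}).map s.toNagata := by
    rw [← hf, Ideal.map_span, Set.image_singleton]
    exact (Ideal.mul_mono_left ((Ideal.span_singleton_le_iff_mem _).2 hz)).trans h
  obtain ⟨g, hg, hgI⟩ := (s.span_algebraMap_mul_map_toNagata_le_iff hI).1 hfI
  have hfT := (s.span_algebraMap_mul_map_toNagata_le_iff hI).2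
    ⟨g, hg, mul_le_span_singleton_mul_traceIdeal (K := K) ha hgI⟩
  rw [← hf, Ideal.map_mul, Ideal.map_span, Set.image_singleton] at hfT
  exact hfT (Ideal.mul_mem_mul (Ideal.mem_span_singleton_self z) hw)

theorem isPStarMD_of_isPruferDomain_nagata [IsDomain D] (hNa : IsPruferDomain s.Nagata) :
    s.IsPStarMD := by
  refine s.isPStarMD_iff_map_traceIdeal_eq_top.2 fun I hI hfg => ?_
  obtain ⟨a, ha, ha0⟩ := Submodule.exists_mem_ne_zero_of_ne_bot hI
  obtain ⟨A, hA⟩ := hNa.exists_mul_eq_span_singleton (Ideal.FG.map hfg s.toNagata)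
    (Ideal.mem_map_of_mem s.toNagata ha)
  rw [mul_comm] at hA
  have hle := hA.ge.trans (mul_map_toNagata_le_span_singleton_mul_map_traceIdeal hfg ha0 hA.le)
  obtain ⟨t, ht, hat⟩ := Ideal.mem_span_singleton_mul.1
    (hle (Ideal.mem_span_singleton_self _))
  have := s.isDomain_nagata
  have ha' : s.toNagata a ≠ 0 := (map_ne_zero_iff _ s.toNagata_injective).2 ha0
  rw [Ideal.eq_top_iff_one, ← mul_left_cancel₀ ha' (hat.trans (mul_one _).symm)]
  exact ht

theorem isPStarMD_iff_isPruferDomain_nagata [IsDomain D] :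
    s.IsPStarMD ↔ IsPruferDomain s.Nagata := by
  refine ⟨fun hs => ?_, isPStarMD_of_isPruferDomain_nagata⟩
  have := s.isDomain_nagata
  have := hs.isBezout_nagata
  exact .of_isBezout s.Nagata

end PStarMD

section QuasiStarPrime

variable [IsFractionRing D K] {s}

theorem IsQuasiStarPrime.map_toNagata_ne_top {P : Ideal D}
    (hP : s.finiteType.IsQuasiStarPrime P) : P.map s.toNagata ≠ ⊤ := by
  intro h
  refine hP.2.ne_top ((Ideal.eq_top_iff_one _).2 ?_)
  rw [hP.1.2, Submodule.mem_comap, Algebra.linearMap_apply, map_one]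
  exact s.one_mem_finiteType_iff_map_eq_top.2 h

theorem IsQuasiStarPrime.comap_map_toNagata {P J : Ideal D}
    (hP : s.finiteType.IsQuasiStarPrime P) (hJ : J.IsPrimary) (hJP : J.radical = P) :
    (J.map s.toNagata).comap s.toNagata = J :=
  s.comap_map_toNagata hJ (hJP ▸ hP.map_toNagata_ne_top)

theorem IsPStarMD.isQuasiStarPrime_comap (hs : s.IsPStarMD) {Q : Ideal s.Nagata}
    (hQ : Q ≠ ⊥) (hQp : Q.IsPrime) : s.finiteType.IsQuasiStarPrime (Q.comap s.toNagata) := by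
  refine ⟨⟨fun h => hQ ?_, ?_⟩, hQp.comap _⟩
  · rw [← hs.map_comap_toNagata Q, h, Ideal.map_bot]
  · rw [hs.comap_star_coeSubmodule, hs.map_comap_toNagata]

theorem IsPStarMD.isPrime_map_toNagata (hs : s.IsPStarMD) {P : Ideal D}
    (hP : s.finiteType.IsQuasiStarPrime P) : (P.map s.toNagata).IsPrime :=
  isPrime_map hs.map_comap_toNagata
    (hP.comap_map_toNagata hP.2.isPrimary hP.2.radical) hP.2

theorem IsPStarMD.isBranched_map_toNagata_iff (hs : s.IsPStarMD) {P : Ideal D}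
    (hP : s.finiteType.IsQuasiStarPrime P) : IsBranched (P.map s.toNagata) ↔ IsBranched P := by
  have hPP := hP.comap_map_toNagata hP.2.isPrimary hP.2.radical
  refine ⟨fun h => hPP ▸ h.comap hs.map_comap_toNagata, ?_⟩
  rintro ⟨J, hJ, hJP, hne⟩
  have hJJ := hP.comap_map_toNagata hJ hJP
  refine ⟨J.map s.toNagata, isPrimary_map hs.map_comap_toNagata hJJ hJ, ?_, fun h => hne ?_⟩
  · rw [radical_map_eq_map_radical hs.map_comap_toNagata hJJ, hJP]
  · rw [← hJJ, h, hPP]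

theorem IsPStarMD.forall_isQuasiStarPrime_iff [IsDomain D] (hs : s.IsPStarMD)
    {p : Ideal s.Nagata → Prop} :
    (∀ P : Ideal D, s.finiteType.IsQuasiStarPrime P → p (P.map s.toNagata)) ↔
      ∀ Q : Ideal s.Nagata, Q ≠ ⊥ → Q.IsPrime → p Q := by
  constructor
  · intro h Q hQ hQp
    rw [← hs.map_comap_toNagata Q]
    exact h _ (hs.isQuasiStarPrime_comap hQ hQp)
  · refine fun h P hP => h _ ?_ (hs.isPrime_map_toNagata hP)
    exact (Ideal.map_eq_bot_iff_of_injective s.toNagata_injective).not.2 hP.1.1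

theorem IsPStarMD.forall_isBranched_not_isStarIdempotent_iff [IsDomain D] (hs : s.IsPStarMD) :
    (∀ P : Ideal D, s.finiteType.IsQuasiStarPrime P → IsBranched P →
      ¬ s.finiteType.IsStarIdempotent (coeSubmodule K P)) ↔
      ∀ Q : Ideal s.Nagata, Q ≠ ⊥ → Q.IsPrime → IsBranched Q → ¬ IsIdempotentElem Q := by
  rw [← hs.forall_isQuasiStarPrime_iff (p := fun Q => IsBranched Q → ¬ IsIdempotentElem Q)]
  refine forall₂_congr fun P hP => ?_
  rw [hs.isBranched_map_toNagata_iff hP, hs.isStarIdempotent_iff]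

theorem IsPStarMD.forall_not_isStarIdempotent_iff [IsDomain D] (hs : s.IsPStarMD) :
    (∀ P : Ideal D, s.finiteType.IsQuasiStarPrime P →
      ¬ s.finiteType.IsStarIdempotent (coeSubmodule K P)) ↔
      ∀ Q : Ideal s.Nagata, Q ≠ ⊥ → Q.IsPrime → ¬ IsIdempotentElem Q := by
  rw [← hs.forall_isQuasiStarPrime_iff (p := fun Q => ¬ IsIdempotentElem Q)]
  exact forall₂_congr fun P _ => by rw [hs.isStarIdempotent_iff]

end QuasiStarPrime

end SemistarOperation

theorem mainTheorem12 {D K : Type*} [CommRing D] [IsDomain D] [Field K] [Algebra D K]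
    [IsFractionRing D K] (s : SemistarOperation D K) :
    (s.IsDiscretePStarMD ↔ IsDiscretePruferDomain s.Nagata) ∧
      (s.IsStronglyDiscretePStarMD ↔ IsStronglyDiscretePruferDomain s.Nagata) := by
  have isPStarMD_iff := s.isPStarMD_iff_isPruferDomain_nagata
  refine ⟨⟨fun h => ?_, fun h => ?_⟩, ⟨fun h => ?_, fun h => ?_⟩⟩
  · have hs := h.isPStarMD
    exact ⟨isPStarMD_iff.1 hs, hs.forall_isBranched_not_isStarIdempotent_iff.1 h.not_idempotent⟩
  · have hs := isPStarMD_iff.2 h.toIsPruferDomain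
    exact ⟨hs, hs.forall_isBranched_not_isStarIdempotent_iff.2 h.not_idempotent⟩
  · have hs := h.isPStarMD
    exact ⟨isPStarMD_iff.1 hs, hs.forall_not_isStarIdempotent_iff.1 h.not_idempotent⟩
  · have hs := isPStarMD_iff.2 h.toIsPruferDomain
    exact ⟨hs, hs.forall_not_isStarIdempotent_iff.2 h.not_idempotent⟩
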